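/- **Setting.** Fix a function-free first-order signature with set $\mathbf P$ of predicate symbols. MKNF formulae are built from atoms $P(t_1,\dots,t_n)$ by $\lnot$, $\land$, $\exists x$ and the modal operators $\mathbf K$ and $\mathbf{not}$; a formula is first-order if it contains no modal operator, and $\mathrm{pr}(\phi)$ is the set of predicate symbols occurring in $\phi$ (similarly for literals and rules below). Under the standard names assumption the Herbrand universe $\Delta$ is the set of constants; $\mathcal I$ is the set of all Herbrand interpretations, i.e. of all sets of ground atoms. For $I\in\mathcal I$ and $M,N\subseteq\mathcal I$, satisfaction of sentences is defined by: $(I,M,N)\models p$ iff $p\in I$ for a ground atom $p$; the usual clauses for $\lnot,\land$; $(I,M,N)\models\exists x\,\phi$ iff $(I,M,N)\models\phi[c/x]$ for some $c\in\Delta$; $(I,M,N)\models\mathbf K\phi$ iff $(J,M,N)\models\phi$ for all $J\in M$; $(I,M,N)\models\mathbf{not}\,\phi$ iff $(J,M,N)\not\models\phi$ for some $J\in N$. For a set $T$ of sentences write $M\models T$ if $(I,M,M)\models\phi$ for all $\phi\in T$ and $I\in M$. An *MKNF interpretation* is a nonempty $M\subseteq\mathcal I$; it is an *MKNF model* of $T$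 if $M\models T$ and for every $M'\supsetneq M$ there are $I'\in M'$ and $\phi\in T$ with $(I',M',M)\not\models\phi$. A *hybrid knowledge base* $\mathcal K=\langle\mathcal O,\mathcal P\rangle$ consists of a set $\mathcal O$ of axioms $\phi$ of a description logic, each with a translation into a first-order sentence $\zeta(\phi)$ (put $\mathrm{pr}(\phi)=\mathrm{pr}(\zeta(\phi))$), and a set $\mathcal P$ of rules $r$, each with a head literal $H(r)$ and a finite set $B(r)$ of body literals, a literal being a ground atom $p$ or a default literal $\mathrm{not}\,p$. Let $\pi(p)=\mathbf K p$, $\pi(\mathrm{not}\,p)=\mathbf{not}\,p$, $\pi(B)=\{\pi(L)\mid L\in B\}$, $\pi(r)=\bigl(\pi(H(r))\subset\bigwedge\pi(B(r))\bigr)$ and $\pi(\mathcal K)=\{\mathbf K\zeta(\phi)\mid\phi\in\mathcal O\}\cup\{\pi(r)\mid r\in\mathcal P\}$. An MKNF model of $\mathcal K$ is an MKNF model of $\pi(\mathcal K)$. A set $U\subseteq\mathbf P$ is a *splitting set* for $\mathcal K$ if for every $\phi\in\mathcal O$, $\mathrm{pr}(\phi)\cap U\ne\emptyset$ implies $\mathrm{pr}(\phi)\subseteq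 U$, and for every $r\in\mathcal P$, $\mathrm{pr}(H(r))\cap U\neq\emptyset$ implies $\mathrm{pr}(r)\subseteq U$. The *bottom* $b_U(\mathcal K)$ consists of the axioms and rules of $\mathcal K$ all of whose predicate symbols lie in $U$; the *top* $t_U(\mathcal K)=\langle t_U(\mathcal O),t_U(\mathcal P)\rangle$ consists of the remaining axioms and rules. For $X\subseteq\mathcal I$ the *reduct* $e_U(\mathcal K,X)$ has the ontology $t_U(\mathcal O)$ and all rules $r'$ for which some $r\in t_U(\mathcal P)$ satisfies $X\models\pi(\{L\in B(r)\mid\mathrm{pr}(L)\subseteq U\})$, $H(r')=H(r)$ and $B(r')=\{L\in B(r)\mid\mathrm{pr}(L)\subseteq\mathbf P\setminus U\}$. A *splitting sequence* for $\mathcal K$ is a sequence $\langle U_\alpha\rangle_{\alpha<\mu}$ of splitting sets for $\mathcal K$, indexed by the ordinals below an ordinal $\mu$, that is monotone ($U_\alpha\subseteq U_\beta$ for $\alpha\le\beta<\mu$), continuous ($U_\alpha=\bigcup_{\eta<\alpha}U_\eta$ for limit ordinals $\alpha<\mu$) and satisfies $\bigcup_{\alpha<\mu}U_\alpha=\mathbf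 P$. A *solution* to $\mathcal K$ with respect to it is a sequence $\langle X_\alpha\rangle_{\alpha<\mu}$ of MKNF interpretations such that 1. $X_0$ is an MKNF model of $b_{U_0}(\mathcal K)$; 2. for every $\alpha$ with $\alpha+1<\mu$, $X_{\alpha+1}$ is an MKNF model of $e_{U_\alpha}\bigl(b_{U_{\alpha+1}}(\mathcal K),\bigcap_{\eta\le\alpha}X_\eta\bigr)$; 3. $X_\alpha=\mathcal I$ for every limit ordinal $\alpha<\mu$. **Theorem (Splitting Sequence Theorem for Hybrid MKNF Knowledge Bases).** Let $\langle U_\alpha\rangle_{\alpha<\mu}$ be a splitting sequence for a hybrid knowledge base $\mathcal K$, and let $M\subseteq\mathcal I$. Then $M$ is an MKNF model of $\mathcal K$ if and only if $M=\bigcap_{\alpha<\mu}X_\alpha$ for some solution $\langle X_\alpha\rangle_{\alpha<\mu}$ to $\mathcal K$ with respect to $\langle U_\alpha\rangle_{\alpha<\mu}$. -/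

import Mathlib

namespace MKNF

universe u v w x

/-- A function-free first-order signature. By the standard names assumption the set `Const` of
constants is also the Herbrand universe. -/
structure Signature where
  /-- predicate symbols -/
  Pred : Type u
  /-- the arity of a predicate symbol -/
  arity : Pred → ℕ
  /-- constants -/
  Const : Type v

/-- Terms with free variables among `n` variables: the signature has no function symbols. -/
inductive Term (S : Signature.{u, v}) (n : ℕ) : Type v
  | var (i : Fin n) : Term S n
  | const (c : S.Const) : Term S n

/-- The value of a term when its variables are replaced by the constants `e`. -/
def Term.val {S : Signature.{u, v}} {n : ℕ} (e : Fin n → S.Const) : Term S n → S.Const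
  | .var i => e i
  | .const c => c

/-- MKNF formulae with free variables among `n` variables; `ex` binds the last of the `n + 1`
variables of its argument. -/
inductive Formula (S : Signature.{u, v}) : ℕ → Type (max u v)
  | atom {n : ℕ} (P : S.Pred) (t : Fin (S.arity P) → Term S n) : Formula S n
  | neg {n : ℕ} (φ : Formula S n) : Formula S n
  | and {n : ℕ} (φ ψ : Formula S n) : Formula S n
  | ex {n : ℕ} (φ : Formula S (n + 1)) : Formula S n
  | know {n : ℕ} (φ : Formula S n) : Formula S n
  | naf {n : ℕ} (φ : Formula S n) : Formula S n

/-- MKNF sentences: formulae without free variables. -/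
abbrev Sentence (S : Signature.{u, v}) := Formula S 0

/-- The set of predicate symbols occurring in a formula. -/
def Formula.preds {S : Signature.{u, v}} : {n : ℕ} → Formula S n → Set S.Pred
  | _, .atom P _ => {P}
  | _, .neg φ => φ.preds
  | _, .and φ ψ => φ.preds ∪ ψ.preds
  | _, .ex φ => φ.preds
  | _, .know φ => φ.preds
  | _, .naf φ => φ.preds

/-- A formula is first-order if it contains no modal operator. -/
def Formula.IsFirstOrder {S : Signature.{u, v}} : {n : ℕ} → Formula S n → Prop
  | _, .atom _ _ => True
  | _, .neg φ => φ.IsFirstOrder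
  | _, .and φ ψ => φ.IsFirstOrder ∧ ψ.IsFirstOrder
  | _, .ex φ => φ.IsFirstOrder
  | _, .know _ => False
  | _, .naf _ => False

/-- Ground atoms. -/
structure GroundAtom (S : Signature.{u, v}) : Type (max u v) where
  pred : S.Pred
  args : Fin (S.arity pred) → S.Const

/-- A Herbrand interpretation is the set of ground atoms that are true in it. -/
abbrev Interp (S : Signature.{u, v}) := Set (GroundAtom S)

/-- Satisfaction in the MKNF structure `(I, M, N)` of the sentence obtained from a formula by
replacing its free variables by the constants `e`. -/
def Formula.Sat {S : Signature.{u, v}} (M N : Set (Interp S)) :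
    {n : ℕ} → Formula S n → Interp S → (Fin n → S.Const) → Prop
  | _, .atom P t, I, e => (⟨P, fun i => (t i).val e⟩ : GroundAtom S) ∈ I
  | _, .neg φ, I, e => ¬ φ.Sat M N I e
  | _, .and φ ψ, I, e => φ.Sat M N I e ∧ ψ.Sat M N I e
  | _, .ex φ, I, e => ∃ c : S.Const, φ.Sat M N I (Fin.snoc e c)
  | _, .know φ, _, e => ∀ J ∈ M, φ.Sat M N J e
  | _, .naf φ, _, e => ∃ J ∈ N, ¬ φ.Sat M N J e

/-- Satisfaction of a sentence in the MKNF structure `(I, M, N)`. -/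
def Holds {S : Signature.{u, v}} (I : Interp S) (M N : Set (Interp S)) (φ : Sentence S) : Prop :=
  φ.Sat M N I Fin.elim0

/-- `M ⊨ T`, for an arbitrary (possibly empty) set `M` of interpretations. -/
def Entails {S : Signature.{u, v}} (M : Set (Interp S)) (T : Set (Sentence S)) : Prop :=
  ∀ φ ∈ T, ∀ I ∈ M, Holds I M M φ

/-- `M` is an S5 model of `T`. -/
def IsS5Model {S : Signature.{u, v}} (M : Set (Interp S)) (T : Set (Sentence S)) : Prop :=
  M.Nonempty ∧ Entails M T

/-- `M` is an MKNF model of the set of sentences `T`. -/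
def IsMKNFModel {S : Signature.{u, v}} (M : Set (Interp S)) (T : Set (Sentence S)) : Prop :=
  IsS5Model M T ∧ ∀ M' : Set (Interp S), M ⊂ M' → ∃ I' ∈ M', ∃ φ ∈ T, ¬ Holds I' M' M φ

/-- A description logic, given by its axioms and their translation into function-free
first-order sentences. -/
structure DescriptionLogic (S : Signature.{u, v}) where
  Axiom : Type w
  toFO : Axiom → Sentence S
  isFirstOrder_toFO : ∀ a, (toFO a).IsFirstOrder

/-- The predicate symbols of an ontology axiom. -/
def DescriptionLogic.preds {S : Signature.{u, v}} (D : DescriptionLogic.{u, v, w} S)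
    (a : D.Axiom) : Set S.Pred :=
  (D.toFO a).preds

/-- A literal is a ground atom or a default-negated ground atom. -/
inductive Literal (S : Signature.{u, v}) : Type (max u v)
  | pos (p : GroundAtom S) : Literal S
  | dnot (p : GroundAtom S) : Literal S

def Literal.preds {S : Signature.{u, v}} : Literal S → Set S.Pred
  | .pos p => {p.pred}
  | .dnot p => {p.pred}

/-- A rule: its head is a literal, its body a finite set of literals. -/
structure Rule (S : Signature.{u, v}) : Type (max u v) where
  head : Literal S
  body : Finset (Literal S)

/-- The predicate symbols occurring in a rule. -/
def Rule.preds {S : Signature.{u, v}} (r : Rule S) : Set S.Pred :=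
  r.head.preds ∪ ⋃ L ∈ r.body, L.preds

/-- A hybrid knowledge base: an ontology together with a generalised logic program. -/
structure HybridKB {S : Signature.{u, v}} (D : DescriptionLogic.{u, v, w} S) where
  ontology : Set D.Axiom
  program : Set (Rule S)

/-- A ground atom as a sentence. -/
def GroundAtom.toSentence {S : Signature.{u, v}} (p : GroundAtom S) : Sentence S :=
  .atom p.pred fun i => .const (p.args i)

/-- `π(p) = K p` and `π(not p) = not p`. -/
def Literal.toMKNF {S : Signature.{u, v}} : Literal S → Sentence S
  | .pos p => .know p.toSentence
  | .dnot p => .naf p.toSentence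

/-- `π(r)`: the material implication `π(H) ⊂ π(L₁) ∧ … ∧ π(L_k)`, written out as
`¬ (π(L₁) ∧ (… ∧ (π(L_k) ∧ ¬ π(H))))` for some enumeration `L₁, …, L_k` of the body. -/
noncomputable def Rule.toMKNF {S : Signature.{u, v}} (r : Rule S) : Sentence S :=
  .neg (r.body.toList.foldr (fun L ψ => .and L.toMKNF ψ) (.neg r.head.toMKNF))

/-- `π(K)`. -/
def HybridKB.toMKNF {S : Signature.{u, v}} {D : DescriptionLogic.{u, v, w} S}
    (K : HybridKB D) : Set (Sentence S) :=
  (fun a => Formula.know (D.toFO a)) '' K.ontology ∪ Rule.toMKNF '' K.program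

/-- `M` is an MKNF model of the hybrid knowledge base `K`. -/
def HybridKB.IsModel {S : Signature.{u, v}} {D : DescriptionLogic.{u, v, w} S}
    (K : HybridKB D) (M : Set (Interp S)) : Prop :=
  IsMKNFModel M K.toMKNF

/-- `U` is a splitting set for `K`. -/
def HybridKB.IsSplittingSet {S : Signature.{u, v}} {D : DescriptionLogic.{u, v, w} S}
    (K : HybridKB D) (U : Set S.Pred) : Prop :=
  (∀ a ∈ K.ontology, (D.preds a ∩ U).Nonempty → D.preds a ⊆ U) ∧
    ∀ r ∈ K.program, (r.head.preds ∩ U).Nonempty → r.preds ⊆ U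

/-- The bottom `b_U(K)` of `K` relative to `U`. -/
def HybridKB.bottom {S : Signature.{u, v}} {D : DescriptionLogic.{u, v, w} S}
    (K : HybridKB D) (U : Set S.Pred) : HybridKB D where
  ontology := {a ∈ K.ontology | D.preds a ⊆ U}
  program := {r ∈ K.program | r.preds ⊆ U}

/-- The top `t_U(K)` of `K` relative to `U`. -/
def HybridKB.top {S : Signature.{u, v}} {D : DescriptionLogic.{u, v, w} S}
    (K : HybridKB D) (U : Set S.Pred) : HybridKB D where
  ontology := K.ontology \ (K.bottom U).ontology
  program := K.program \ (K.bottom U).program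

/-- The splitting set reduct `e_U(K, X)`. -/
def HybridKB.reduct {S : Signature.{u, v}} {D : DescriptionLogic.{u, v, w} S}
    (K : HybridKB D) (U : Set S.Pred) (X : Set (Interp S)) : HybridKB D where
  ontology := (K.top U).ontology
  program := {r' | ∃ r ∈ (K.top U).program,
    Entails X (Literal.toMKNF '' {L | L ∈ r.body ∧ L.preds ⊆ U}) ∧
    r'.head = r.head ∧
    {L | L ∈ r'.body} = {L | L ∈ r.body ∧ L.preds ⊆ Uᶜ}}

/-- `⟨U α⟩_{α < μ}` is a splitting sequence for `K`: a monotone, continuous sequence of splitting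
sets that covers all predicate symbols. Only the values of `U` below `μ` matter. -/
structure HybridKB.IsSplittingSequence {S : Signature.{u, v}} {D : DescriptionLogic.{u, v, w} S}
    (K : HybridKB D) (μ : Ordinal.{x}) (U : Ordinal.{x} → Set S.Pred) : Prop where
  splitting : ∀ α < μ, K.IsSplittingSet (U α)
  monotone : ∀ α β, α ≤ β → β < μ → U α ⊆ U β
  continuous : ∀ α < μ, Order.IsSuccLimit α → U α = ⋃ η < α, U η
  cover : ⋃ α < μ, U α = Set.univ

/-- `⟨X α⟩_{α < μ}` is a solution to `K` with respect to `⟨U α⟩_{α < μ}`. Only the values of `X`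
and `U` below `μ` matter. -/
structure HybridKB.IsSolution {S : Signature.{u, v}} {D : DescriptionLogic.{u, v, w} S}
    (K : HybridKB D) (μ : Ordinal.{x}) (U : Ordinal.{x} → Set S.Pred)
    (X : Ordinal.{x} → Set (Interp S)) : Prop where
  nonempty : ∀ α < μ, (X α).Nonempty
  zero : 0 < μ → (K.bottom (U 0)).IsModel (X 0)
  succ : ∀ α, α + 1 < μ →
    ((K.bottom (U (α + 1))).reduct (U α) (⋂ η ≤ α, X η)).IsModel (X (α + 1))
  limit : ∀ α < μ, Order.IsSuccLimit α → X α = Set.univ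

end MKNF

/-!
Assign to a predicate symbol the first index at which it occurs in the splitting sequence. The
symbols of an axiom then have equal rank, and a body literal has at most the rank of the head.
As `π(L)` speaks about the single predicate symbol of `L`, its truth in `(I, M, N)` depends only on
the projections of `M` and `N` to one rank, even where the members of `M` correlate different
ranks. Hence `(I, M', M)` satisfies `π(K)` exactly if each layer of `K`, with its lower body
literals evaluated in `(M', M)`, is satisfied by the projections to that rank.

A model `M` is therefore the product of its projections, each a maximal model of its layer:
otherwise the product, or `M` with one larger projection, would contradict the maximality of `M`.
Conversely, let each projection of the product `M` be a model of its layer and let `M' ⊇ M` satisfy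
`π(K)` relative to `M`. By well-founded induction on the rank, `M'` has the same projections as
`M`: lower literals have the same truth values, and the projection of `M` is maximal. The bottoms
and reducts in the definition of a solution are these layers, and no symbol has a limit rank.
-/

namespace MKNF

section Satisfaction

variable {S : Signature}

/-- The predicate symbol of a literal. -/
def Literal.pred : Literal S → S.Pred
  | .pos p => p.pred
  | .dnot p => p.pred

theorem Literal.preds_eq_singleton (L : Literal S) : L.preds = {L.pred} := by
  cases L <;> rfl

theorem Rule.preds_subset_iff {r : Rule S} {V : Set S.Pred} :
    r.preds ⊆ V ↔ r.head.pred ∈ V ∧ ∀ L ∈ r.body, L.pred ∈ V := by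
  simp only [Rule.preds, Literal.preds_eq_singleton, Set.union_subset_iff,
    Set.iUnion₂_subset_iff, Set.singleton_subset_iff]

theorem Formula.preds_nonempty {n : ℕ} (φ : Formula S n) : φ.preds.Nonempty := by
  induction φ with
  | atom P => exact ⟨P, rfl⟩
  | and _ _ ih => exact ih.mono Set.subset_union_left
  | neg _ ih | ex _ ih | know _ ih | naf _ ih => exact ih

theorem Formula.IsFirstOrder.sat_congr {n : ℕ} {φ : Formula S n} (hφ : φ.IsFirstOrder)
    {M N M' N' : Set (Interp S)} {I I' : Interp S}
    (h : ∀ p : GroundAtom S, p.pred ∈ φ.preds → (p ∈ I ↔ p ∈ I')) (e : Fin n → S.Const) :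
    φ.Sat M N I e ↔ φ.Sat M' N' I' e := by
  induction φ with
  | atom => exact h _ rfl
  | neg _ ih => exact not_congr (ih hφ h e)
  | and _ _ ih₁ ih₂ =>
    exact and_congr (ih₁ hφ.1 (fun p hp => h p (Or.inl hp)) e)
      (ih₂ hφ.2 (fun p hp => h p (Or.inr hp)) e)
  | ex _ ih => exact exists_congr fun c => ih hφ h _
  | know | naf => exact hφ.elim

/-- Satisfaction of `π(L)` in `(I, M, N)`, which does not depend on `I`. -/
def Literal.Sat (M N : Set (Interp S)) : Literal S → Prop
  | .pos p => ∀ J ∈ M, p ∈ J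
  | .dnot p => ∃ J ∈ N, p ∉ J

theorem Literal.holds_toMKNF_iff {L : Literal S} {I : Interp S} {M N : Set (Interp S)} :
    Holds I M N L.toMKNF ↔ L.Sat M N := by
  cases L <;> rfl

theorem Literal.Sat.anti {L : Literal S} {M M' N : Set (Interp S)} (hL : L.Sat M' N)
    (h : M ⊆ M') : L.Sat M N := by
  cases L with
  | pos => exact fun J hJ => hL J (h hJ)
  | dnot => exact hL

/-- Satisfaction of `π(r)` in `(I, M, N)`, which does not depend on `I`. -/
def Rule.Sat (M N : Set (Interp S)) (r : Rule S) : Prop :=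
  (∀ L ∈ r.body, L.Sat M N) → r.head.Sat M N

theorem holds_foldr_and_iff {I : Interp S} {M N : Set (Interp S)} {ψ : Sentence S}
    (l : List (Literal S)) :
    Holds I M N (l.foldr (fun L ψ => .and L.toMKNF ψ) ψ) ↔
      (∀ L ∈ l, L.Sat M N) ∧ Holds I M N ψ := by
  induction l with
  | nil => simp only [List.foldr_nil, List.not_mem_nil, false_implies, implies_true, true_and]
  | cons L l ih =>
    simp only [List.foldr_cons, List.forall_mem_cons, and_assoc]
    exact and_congr L.holds_toMKNF_iff ih

theorem Rule.holds_toMKNF_iff {r : Rule S} {I : Interp S} {M N : Set (Interp S)} :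
    Holds I M N r.toMKNF ↔ r.Sat M N := by
  have hhead : Holds I M N (.neg r.head.toMKNF) ↔ ¬ r.head.Sat M N :=
    not_congr r.head.holds_toMKNF_iff
  refine (not_congr (holds_foldr_and_iff r.body.toList)).trans ?_
  simp only [hhead, Finset.mem_toList, not_and_not_right, Rule.Sat]

end Satisfaction

namespace HybridKB

variable {S : Signature} {D : DescriptionLogic S} {K : HybridKB D}

/-- Satisfaction of `π(K)` in `(I, M, N)`, which does not depend on `I`. -/
def Sat (K : HybridKB D) (M N : Set (Interp S)) : Prop :=
  (∀ a ∈ K.ontology, ∀ J ∈ M, Holds J M N (D.toFO a)) ∧ ∀ r ∈ K.program, r.Sat M N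

theorem forall_holds_toMKNF_iff {I : Interp S} {M N : Set (Interp S)} :
    (∀ φ ∈ K.toMKNF, Holds I M N φ) ↔ K.Sat M N := by
  simp only [toMKNF, Set.mem_union, or_imp, forall_and, Set.forall_mem_image,
    Rule.holds_toMKNF_iff]
  rfl

theorem isModel_iff {M : Set (Interp S)} :
    K.IsModel M ↔ M.Nonempty ∧ K.Sat M M ∧ ∀ M', M ⊆ M' → K.Sat M' M → M' ⊆ M := by
  have hsat {M' : Set (Interp S)} (hM' : M'.Nonempty) :
      (∀ I ∈ M', ∀ φ ∈ K.toMKNF, Holds I M' M φ) ↔ K.Sat M' M := by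
    simp only [forall_holds_toMKNF_iff]
    exact ⟨fun h => h _ hM'.some_mem, fun h _ _ => h⟩
  have hmax (M' : Set (Interp S)) (hM' : M'.Nonempty) :
      (M ⊂ M' → ∃ I ∈ M', ∃ φ ∈ K.toMKNF, ¬ Holds I M' M φ) ↔
        (M ⊆ M' → K.Sat M' M → M' ⊆ M) := by
    rw [ssubset_iff_subset_not_subset, ← hsat hM']
    grind
  refine ⟨fun ⟨⟨hne, h⟩, hM⟩ => ?_, fun ⟨hne, h, hM⟩ => ?_⟩
  · exact ⟨hne, (hsat hne).1 fun I hI φ hφ => h φ hφ I hI,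
      fun M' hMM' => (hmax M' (hne.mono hMM')).1 (hM M') hMM'⟩
  · exact ⟨⟨hne, fun φ hφ I hI => (hsat hne).2 h I hI φ hφ⟩,
      fun M' hMM' => (hmax M' (hne.mono hMM'.1)).2 (hM M') hMM'⟩

end HybridKB

section Saturation

variable {S : Signature} {V : Set S.Pred} {M M' N N' : Set (Interp S)}

/-- The ground atoms of `I` whose predicate symbols lie in `V`. -/
def restrict (V : Set S.Pred) (I : Interp S) : Interp S := {p ∈ I | p.pred ∈ V}

theorem restrict_eq_restrict_iff {I J : Interp S} :
    restrict V I = restrict V J ↔ ∀ p : GroundAtom S, p.pred ∈ V → (p ∈ I ↔ p ∈ J) := by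
  simp only [restrict, Set.ext_iff, Set.mem_ofPred_eq, and_congr_left_iff]

/-- The saturation of `M` relative to `V`: all interpretations that agree on `V` with a member of
`M`. The set `M` says nothing about the predicate symbols outside `V` when it is equal to its
saturation, and two sets have the same projections to `V` when their saturations are equal. -/
def saturate (V : Set S.Pred) (M : Set (Interp S)) : Set (Interp S) :=
  restrict V ⁻¹' (restrict V '' M)

theorem subset_saturate : M ⊆ saturate V M :=
  Set.subset_preimage_image _ _

theorem saturate_mono (h : M ⊆ N) : saturate V M ⊆ saturate V N :=
  Set.preimage_mono (Set.image_mono h)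

theorem saturate_saturate : saturate V (saturate V M) = saturate V M :=
  Set.preimage_image_preimage

theorem Formula.IsFirstOrder.forall_mem_saturate_iff {φ : Sentence S} (hφ : φ.IsFirstOrder)
    (hV : φ.preds ⊆ V) :
    (∀ J ∈ saturate V M, Holds J M' N' φ) ↔ ∀ J ∈ M, Holds J M N φ := by
  constructor
  · exact fun h J hJ => (hφ.sat_congr (fun _ _ => Iff.rfl) _).1 (h J (subset_saturate hJ))
  · rintro h J ⟨J', hJ', hJJ'⟩
    have hagree := restrict_eq_restrict_iff.1 hJJ'
    exact (hφ.sat_congr (fun p hp => hagree p (hV hp)) _).1 (h J' hJ')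

theorem Literal.sat_saturate_iff {L : Literal S} (hL : L.pred ∈ V) :
    L.Sat (saturate V M) (saturate V N) ↔ L.Sat M N := by
  have forall_mem_iff (p : GroundAtom S) (hp : p.pred ∈ V) (A : Set (Interp S)) :
      (∀ J ∈ saturate V A, p ∈ J) ↔ ∀ J ∈ A, p ∈ J :=
    Formula.IsFirstOrder.forall_mem_saturate_iff (φ := p.toSentence) (M' := ∅) (N := ∅) (N' := ∅)
      trivial (Set.singleton_subset_iff.2 hp)
  cases L with
  | pos p => exact forall_mem_iff p hL M
  | dnot p =>
    simpa only [Literal.Sat, not_forall, exists_prop] using not_congr (forall_mem_iff p hL N)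

theorem Literal.sat_congr {L : Literal S} (hL : L.pred ∈ V) (hM : saturate V M = saturate V M')
    (hN : saturate V N = saturate V N') : L.Sat M N ↔ L.Sat M' N' := by
  rw [← sat_saturate_iff hL, hM, hN, sat_saturate_iff hL]

namespace HybridKB

variable {D : DescriptionLogic S} {K : HybridKB D}

/-- The predicate symbols occurring in a hybrid knowledge base. -/
def preds (K : HybridKB D) : Set S.Pred :=
  (⋃ a ∈ K.ontology, D.preds a) ∪ ⋃ r ∈ K.program, r.preds

theorem preds_subset_iff :
    K.preds ⊆ V ↔ (∀ a ∈ K.ontology, D.preds a ⊆ V) ∧ ∀ r ∈ K.program, r.preds ⊆ V := by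
  simp only [preds, Set.union_subset_iff, Set.iUnion₂_subset_iff]

theorem sat_saturate_iff (hV : K.preds ⊆ V) :
    K.Sat (saturate V M) (saturate V N) ↔ K.Sat M N := by
  obtain ⟨hO, hP⟩ := preds_subset_iff.1 hV
  refine and_congr (forall₂_congr fun a ha => ?_) (forall₂_congr fun r hr => ?_)
  · exact (D.isFirstOrder_toFO a).forall_mem_saturate_iff (hO a ha)
  · obtain ⟨hhead, hbody⟩ := Rule.preds_subset_iff.1 (hP r hr)
    exact imp_congr (forall₂_congr fun L hL => Literal.sat_saturate_iff (hbody L hL))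
      (Literal.sat_saturate_iff hhead)

theorem sat_congr (hV : K.preds ⊆ V) (hM : saturate V M = saturate V M')
    (hN : saturate V N = saturate V N') : K.Sat M N ↔ K.Sat M' N' := by
  rw [← sat_saturate_iff hV, hM, hN, sat_saturate_iff hV]

theorem IsModel.saturate_eq (hM : K.IsModel M) (hV : K.preds ⊆ V) : saturate V M = M := by
  obtain ⟨-, hsat, hmax⟩ := isModel_iff.1 hM
  exact (hmax _ subset_saturate ((sat_congr hV saturate_saturate rfl).2 hsat)).antisymm
    subset_saturate

theorem isModel_iff_eq_univ_of_eq_empty (hO : K.ontology = ∅) (hP : K.program = ∅) :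
    K.IsModel M ↔ M = Set.univ := by
  have hsat (A B : Set (Interp S)) : K.Sat A B := by
    simp only [Sat, hO, hP, Set.mem_empty_iff_false, false_implies, implies_true, and_self]
  rw [isModel_iff]
  constructor
  · exact fun ⟨_, _, hmax⟩ => Set.univ_subset_iff.1 (hmax _ (Set.subset_univ _) (hsat _ _))
  · rintro rfl
    exact ⟨Set.univ_nonempty, hsat _ _, fun _ _ _ => Set.subset_univ _⟩

end HybridKB

end Saturation

section LayerFamily

variable {S : Signature} {ι : Type*} {rk : S.Pred → ι} {s t : Set ι} {X : ι → Set (Interp S)}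

/-- For `i ∈ s`, the set `X i` is nonempty and determined by its projection to the predicate
symbols of rank `i`. The intersection of such a family is the product of these projections. -/
structure IsLayerFamily (rk : S.Pred → ι) (s : Set ι) (X : ι → Set (Interp S)) : Prop where
  nonempty : ∀ i ∈ s, (X i).Nonempty
  saturate_eq : ∀ i ∈ s, saturate (rk ⁻¹' {i}) (X i) = X i

/-- The interpretation that agrees with `I i` on the predicate symbols of rank `i`. -/
def glue (rk : S.Pred → ι) (I : ι → Interp S) : Interp S := {p | p ∈ I (rk p.pred)}

theorem restrict_glue (I : ι → Interp S) (i : ι) :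
    restrict (rk ⁻¹' {i}) (glue rk I) = restrict (rk ⁻¹' {i}) (I i) := by
  refine restrict_eq_restrict_iff.2 fun p hp => ?_
  rw [← Set.mem_singleton_iff.1 hp]
  rfl

theorem isLayerFamily_saturate {N : ι → Set (Interp S)} (hN : ∀ i ∈ s, (N i).Nonempty) :
    IsLayerFamily rk s fun i => saturate (rk ⁻¹' {i}) (N i) where
  nonempty i hi := (hN i hi).mono subset_saturate
  saturate_eq _ _ := saturate_saturate

namespace IsLayerFamily

theorem mono (hX : IsLayerFamily rk s X) (hts : t ⊆ s) : IsLayerFamily rk t X where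
  nonempty i hi := hX.nonempty i (hts hi)
  saturate_eq i hi := hX.saturate_eq i (hts hi)

theorem glue_mem_biInter (hX : IsLayerFamily rk s X) {I : ι → Interp S} (hI : I ∈ s.pi X) :
    glue rk I ∈ ⋂ i ∈ s, X i := by
  refine Set.mem_iInter₂.2 fun i hi => ?_
  rw [← hX.saturate_eq i hi]
  exact ⟨I i, hI i hi, (restrict_glue I i).symm⟩

theorem pi_nonempty (hX : IsLayerFamily rk s X) : (s.pi X).Nonempty := by
  choose I hI using hX.nonempty
  classical
  exact ⟨fun i => if hi : i ∈ s then I i hi else ∅,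
    fun i hi => by simpa only [dif_pos hi] using hI i hi⟩

theorem biInter_nonempty (hX : IsLayerFamily rk s X) : (⋂ i ∈ s, X i).Nonempty := by
  obtain ⟨I, hI⟩ := hX.pi_nonempty
  exact ⟨_, hX.glue_mem_biInter hI⟩

theorem saturate_biInter (hX : IsLayerFamily rk s X) {i : ι} (hi : i ∈ s) :
    saturate (rk ⁻¹' {i}) (⋂ j ∈ s, X j) = X i := by
  classical
  refine Set.Subset.antisymm ?_ fun J hJ => ?_
  · exact (saturate_mono (Set.biInter_subset_of_mem hi)).trans (hX.saturate_eq i hi).le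
  · obtain ⟨I, hI⟩ := hX.pi_nonempty
    have hupdate : Function.update I i J ∈ s.pi X :=
      (Set.update_mem_pi_iff_of_mem hI).2 fun _ => hJ
    exact ⟨_, hX.glue_mem_biInter hupdate, by rw [restrict_glue, Function.update_self]⟩

end IsLayerFamily

end LayerFamily

section Stratification

open scoped Classical in
/-- The rule `r` without the body literals whose rank is not `i`. -/
noncomputable def Rule.layer {S : Signature} {ι : Type*} (rk : S.Pred → ι) (i : ι)
    (r : Rule S) : Rule S where
  head := r.head
  body := {L ∈ r.body | rk L.pred = i}

namespace Rule

variable {S : Signature} {ι : Type*} {rk : S.Pred → ι} {i : ι} {r r' : Rule S}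

theorem mem_body_layer {L : Literal S} :
    L ∈ (r.layer rk i).body ↔ L ∈ r.body ∧ rk L.pred = i := by
  simp only [layer, Finset.mem_filter]

theorem layer_eq_iff :
    r.layer rk i = r' ↔
      r'.head = r.head ∧ ∀ L, L ∈ r'.body ↔ L ∈ r.body ∧ rk L.pred = i := by
  obtain ⟨head', body'⟩ := r'
  simp only [layer, mk.injEq, Finset.ext_iff, Finset.mem_filter, eq_comm (a := head'),
    iff_comm (b := _ ∈ body')]

end Rule

/-- The literals `L` with `Z ⊨ π(L)`; these are all literals when `Z` is empty. -/
def entailedLiterals {S : Signature} (Z : Set (Interp S)) : Set (Literal S) :=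
  {L | Entails Z {L.toMKNF}}

theorem mem_entailedLiterals_iff {S : Signature} {Z : Set (Interp S)} (hZ : Z.Nonempty)
    {L : Literal S} : L ∈ entailedLiterals Z ↔ L.Sat Z Z := by
  simp only [entailedLiterals, Entails, Set.mem_ofPred_eq, Set.mem_singleton_iff, forall_eq,
    Literal.holds_toMKNF_iff]
  exact ⟨fun h => h _ hZ.some_mem, fun h _ _ => h⟩

theorem entails_image_toMKNF_iff {S : Signature} {Z : Set (Interp S)} {A : Set (Literal S)} :
    Entails Z (Literal.toMKNF '' A) ↔ A ⊆ entailedLiterals Z := by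
  simp only [Entails, Set.forall_mem_image, entailedLiterals, Set.subset_def, Set.mem_ofPred_eq,
    Set.mem_singleton_iff, forall_eq]

namespace HybridKB

variable {S : Signature} {D : DescriptionLogic S} {K : HybridKB D} {ι : Type*} {rk : S.Pred → ι}
  {i : ι} {s : Set ι} {M M' N Z : Set (Interp S)} {T T' : Set (Literal S)}

section PartialOrder

variable [PartialOrder ι]

/-- `K` is stratified by `rk`: all predicate symbols of an axiom have the same rank, and those in
the body of a rule have at most the rank of the one in the head. -/
structure IsStratified (K : HybridKB D) (rk : S.Pred → ι) : Prop where
  ontology : ∀ a ∈ K.ontology, ∀ P ∈ D.preds a, ∀ Q ∈ D.preds a, rk P = rk Q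
  program : ∀ r ∈ K.program, ∀ L ∈ r.body, rk L.pred ≤ rk r.head.pred

theorem IsStratified.axiom_preds_subset_preimage_iff (hK : K.IsStratified rk) {a : D.Axiom}
    (ha : a ∈ K.ontology) {P : S.Pred} (hP : P ∈ D.preds a) {A : Set ι} :
    D.preds a ⊆ rk ⁻¹' A ↔ rk P ∈ A :=
  ⟨fun h => h hP, fun h Q hQ => by rwa [Set.mem_preimage, hK.ontology a ha Q hQ P hP]⟩

theorem IsStratified.rule_preds_subset_preimage_Iic_iff (hK : K.IsStratified rk) {r : Rule S}
    (hr : r ∈ K.program) : r.preds ⊆ rk ⁻¹' Set.Iic i ↔ rk r.head.pred ≤ i :=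
  Rule.preds_subset_iff.trans
    ⟨fun h => h.1, fun h => ⟨h, fun L hL => (hK.program r hr L hL).trans h⟩⟩

/-- The axioms of rank `i` and the rules of `K` whose heads have rank `i`, after evaluation of the
body literals of smaller rank under the assumption that `T` is the set of true literals. -/
def layerReduct (K : HybridKB D) (rk : S.Pred → ι) (i : ι) (T : Set (Literal S)) :
    HybridKB D where
  ontology := {a ∈ K.ontology | D.preds a ⊆ rk ⁻¹' {i}}
  program := Rule.layer rk i ''
    {r ∈ K.program | rk r.head.pred = i ∧ ∀ L ∈ r.body, rk L.pred < i → L ∈ T}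

theorem preds_layerReduct_subset : (K.layerReduct rk i T).preds ⊆ rk ⁻¹' {i} := by
  refine preds_subset_iff.2 ⟨fun a ha => ha.2, Set.forall_mem_image.2 fun r hr => ?_⟩
  exact Rule.preds_subset_iff.2 ⟨hr.2.1, fun L hL => (Rule.mem_body_layer.1 hL).2⟩

theorem layerReduct_program_subset (h : ∀ L : Literal S, rk L.pred < i → L ∈ T → L ∈ T') :
    (K.layerReduct rk i T).program ⊆ (K.layerReduct rk i T').program :=
  Set.image_mono fun _ ⟨hr, hri, hT⟩ => ⟨hr, hri, fun L hL hlt => h L hlt (hT L hL hlt)⟩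

theorem layerReduct_congr (h : ∀ L : Literal S, rk L.pred < i → (L ∈ T ↔ L ∈ T')) :
    K.layerReduct rk i T = K.layerReduct rk i T' :=
  congrArg (HybridKB.mk _) ((layerReduct_program_subset fun L hL => (h L hL).1).antisymm
    (layerReduct_program_subset fun L hL => (h L hL).2))

theorem Sat.layerReduct_anti (hsat : (K.layerReduct rk i T').Sat M N)
    (h : ∀ L : Literal S, rk L.pred < i → L ∈ T → L ∈ T') : (K.layerReduct rk i T).Sat M N :=
  ⟨hsat.1, fun r hr => hsat.2 r (layerReduct_program_subset h hr)⟩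

theorem Sat.layerReduct (hK : K.IsStratified rk) (h : K.Sat M N) (i : ι) :
    (K.layerReduct rk i {L | L.Sat M N}).Sat M N := by
  refine ⟨fun a ha => h.1 a ha.1, Set.forall_mem_image.2 ?_⟩
  rintro r ⟨hr, rfl, hlower⟩ hlayer
  refine h.2 r hr fun L hL => ?_
  rcases (hK.program r hr L hL).lt_or_eq with hlt | heq
  · exact hlower L hL hlt
  · exact hlayer L (Rule.mem_body_layer.2 ⟨hL, heq⟩)

theorem sat_of_forall_layerReduct (hK : K.IsStratified rk)
    (h : ∀ P, (K.layerReduct rk (rk P) {L | L.Sat M N}).Sat M N) : K.Sat M N := by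
  constructor
  · intro a ha
    obtain ⟨P, hP⟩ := (D.toFO a).preds_nonempty
    exact (h P).1 a ⟨ha, (hK.axiom_preds_subset_preimage_iff ha hP).2 rfl⟩
  · intro r hr hbody
    have hlayer : (r.layer rk (rk r.head.pred)).Sat M N :=
      (h r.head.pred).2 _ ⟨r, ⟨hr, rfl, fun L hL _ => hbody L hL⟩, rfl⟩
    exact hlayer fun L hL => hbody L (Rule.mem_body_layer.1 hL).1

theorem IsModel.subset_of_forall_layerReduct (hK : K.IsStratified rk) (hM : K.IsModel M)
    (hMM' : M ⊆ M') (h : ∀ P, (K.layerReduct rk (rk P) {L | L.Sat M M}).Sat M' M) : M' ⊆ M :=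
  (isModel_iff.1 hM).2.2 M' hMM' <| sat_of_forall_layerReduct hK fun P =>
    (h P).layerReduct_anti fun _ _ hL => hL.anti hMM'

theorem IsModel.biInter_saturate (hK : K.IsStratified rk) (hs : ∀ P, rk P ∈ s)
    (hM : K.IsModel M) : ⋂ i ∈ s, saturate (rk ⁻¹' {i}) M = M := by
  obtain ⟨hne, hsat, -⟩ := isModel_iff.1 hM
  have hsub : M ⊆ ⋂ i ∈ s, saturate (rk ⁻¹' {i}) M :=
    Set.subset_iInter₂ fun _ _ => subset_saturate
  refine (hM.subset_of_forall_layerReduct hK hsub fun P => ?_).antisymm hsub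
  have hfamily : IsLayerFamily rk s fun i => saturate (rk ⁻¹' {i}) M :=
    isLayerFamily_saturate fun _ _ => hne
  exact (sat_congr preds_layerReduct_subset (hfamily.saturate_biInter (hs P)) rfl).2
    (hsat.layerReduct hK _)

theorem IsModel.layerReduct (hK : K.IsStratified rk) (hM : K.IsModel M) (i : ι) :
    (K.layerReduct rk i {L | L.Sat M M}).IsModel (saturate (rk ⁻¹' {i}) M) := by
  obtain ⟨hne, hsat, -⟩ := isModel_iff.1 hM
  refine isModel_iff.2 ⟨hne.mono subset_saturate,
    (sat_saturate_iff preds_layerReduct_subset).2 (hsat.layerReduct hK i), fun Y hY hYsat => ?_⟩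
  classical
  -- `M'` is `M` with its projection to layer `i` enlarged to that of `Y`.
  let N : ι → Set (Interp S) := Function.update (fun _ => M) i Y
  let M' : Set (Interp S) := ⋂ j ∈ Set.univ, saturate (rk ⁻¹' {j}) (N j)
  have hN_self : N i = Y := Function.update_self ..
  have hN_of_ne {j : ι} (hj : j ≠ i) : N j = M := Function.update_of_ne hj ..
  have hMN (j : ι) : M ⊆ N j := by
    rcases eq_or_ne j i with rfl | hj
    · exact hN_self ▸ subset_saturate.trans hY
    · exact (hN_of_ne hj).ge
  have hproj (j : ι) : saturate (rk ⁻¹' {j}) M' = saturate (rk ⁻¹' {j}) (N j) :=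
    (isLayerFamily_saturate fun j _ => hne.mono (hMN j)).saturate_biInter (Set.mem_univ j)
  have hMM' : M ⊆ M' := Set.subset_iInter₂ fun j _ => (hMN j).trans subset_saturate
  have hM'M : M' ⊆ M := by
    refine hM.subset_of_forall_layerReduct hK hMM' fun P => ?_
    refine (sat_congr preds_layerReduct_subset (hproj _) rfl).2 ?_
    rcases eq_or_ne (rk P) i with rfl | hP
    · rw [hN_self]
      exact (sat_congr preds_layerReduct_subset rfl saturate_saturate).1 hYsat
    · rw [hN_of_ne hP]
      exact hsat.layerReduct hK _
  calc Y ⊆ saturate (rk ⁻¹' {i}) Y := subset_saturate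
    _ = saturate (rk ⁻¹' {i}) M' := by rw [hproj, hN_self]
    _ ⊆ saturate (rk ⁻¹' {i}) M := saturate_mono hM'M

theorem isModel_of_forall_layerReduct [WellFoundedLT ι] (hK : K.IsStratified rk)
    (hs : ∀ P, rk P ∈ s) (hne : M.Nonempty) (hprod : ⋂ i ∈ s, saturate (rk ⁻¹' {i}) M ⊆ M)
    (h : ∀ i ∈ s, (K.layerReduct rk i {L | L.Sat M M}).IsModel (saturate (rk ⁻¹' {i}) M)) :
    K.IsModel M := by
  have hlayer (i : ι) (hi : i ∈ s) := (isModel_iff.1 (h i hi)).2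
  refine isModel_iff.2 ⟨hne, sat_of_forall_layerReduct hK fun P => ?_, fun M' hMM' hsat => ?_⟩
  · exact (sat_saturate_iff preds_layerReduct_subset).1 (hlayer _ (hs P)).1
  suffices hsub : ∀ i ∈ s, M' ⊆ saturate (rk ⁻¹' {i}) M from (Set.subset_iInter₂ hsub).trans hprod
  intro i
  induction i using WellFoundedLT.induction with
  | ind i ih =>
  intro hi
  have hlower (L : Literal S) (hL : rk L.pred < i) (hLM : L.Sat M M) : L.Sat M' M := by
    have hproj : saturate (rk ⁻¹' {rk L.pred}) M' = saturate (rk ⁻¹' {rk L.pred}) M :=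
      ((saturate_mono (ih _ hL (hs _))).trans saturate_saturate.le).antisymm (saturate_mono hMM')
    exact (Literal.sat_congr (V := rk ⁻¹' {rk L.pred}) rfl hproj rfl).2 hLM
  refine subset_saturate.trans ((hlayer i hi).2 _ (saturate_mono hMM') ?_)
  exact (sat_saturate_iff preds_layerReduct_subset).2
    ((hsat.layerReduct hK i).layerReduct_anti hlower)

/-- `X i` is a model of layer `i` of `K` for every `i ∈ s`, where the literals of smaller rank are
evaluated in the preceding members of the family. -/
def IsLayerSolution (K : HybridKB D) (rk : S.Pred → ι) (s : Set ι) (X : ι → Set (Interp S)) :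
    Prop :=
  ∀ i ∈ s, (K.layerReduct rk i (entailedLiterals (⋂ j < i, X j))).IsModel (X i)

variable {X : ι → Set (Interp S)}

theorem IsLayerSolution.isLayerFamily (hX : K.IsLayerSolution rk s X) : IsLayerFamily rk s X where
  nonempty i hi := (isModel_iff.1 (hX i hi)).1
  saturate_eq i hi := (hX i hi).saturate_eq preds_layerReduct_subset

theorem layerReduct_entailedLiterals (hX : IsLayerFamily rk s X) (hs : IsLowerSet s) (hi : i ∈ s) :
    K.layerReduct rk i (entailedLiterals (⋂ j < i, X j)) =
      K.layerReduct rk i {L | L.Sat (⋂ j ∈ s, X j) (⋂ j ∈ s, X j)} := by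
  have hlower : IsLayerFamily rk (Set.Iio i) X := hX.mono fun j hj => hs (Set.mem_Iio.1 hj).le hi
  refine layerReduct_congr fun L hL => (mem_entailedLiterals_iff hlower.biInter_nonempty).trans ?_
  have hproj := (hlower.saturate_biInter hL).trans (hX.saturate_biInter (hs hL.le hi)).symm
  exact Literal.sat_congr (V := rk ⁻¹' {rk L.pred}) rfl hproj hproj

theorem IsStratified.isModel_iff_exists_isLayerSolution [WellFoundedLT ι] (hK : K.IsStratified rk)
    (hs : IsLowerSet s) (hrk : ∀ P, rk P ∈ s) :
    K.IsModel M ↔ ∃ X, K.IsLayerSolution rk s X ∧ M = ⋂ i ∈ s, X i := by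
  constructor
  · intro hM
    have hprod := hM.biInter_saturate hK hrk
    have hfamily : IsLayerFamily rk s fun i => saturate (rk ⁻¹' {i}) M :=
      isLayerFamily_saturate fun _ _ => (isModel_iff.1 hM).1
    refine ⟨_, fun i hi => ?_, hprod.symm⟩
    rw [layerReduct_entailedLiterals hfamily hs hi, hprod]
    exact hM.layerReduct hK i
  · rintro ⟨X, hX, rfl⟩
    have hfamily := hX.isLayerFamily
    refine isModel_of_forall_layerReduct hK hrk hfamily.biInter_nonempty ?_ fun i hi => ?_
    · exact Set.iInter₂_mono fun i hi => (hfamily.saturate_biInter hi).le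
    · rw [hfamily.saturate_biInter hi, ← layerReduct_entailedLiterals hfamily hs hi]
      exact hX i hi

theorem IsStratified.bottom_preimage_Iic_bot [OrderBot ι] (hK : K.IsStratified rk) :
    K.bottom (rk ⁻¹' Set.Iic ⊥) = K.layerReduct rk ⊥ T := by
  have hlayer {r : Rule S} (hr : r ∈ K.program) (hhead : rk r.head.pred = ⊥) :
      r.layer rk ⊥ = r :=
    Rule.layer_eq_iff.2 ⟨rfl, fun L => (and_iff_left_of_imp fun hL =>
      le_bot_iff.1 ((hK.program r hr L hL).trans hhead.le)).symm⟩
  refine congrArg₂ HybridKB.mk (by rw [Set.Iic_bot]) (Set.ext fun r => ⟨?_, ?_⟩)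
  · rintro ⟨hr, hpreds⟩
    have hhead := le_bot_iff.1 ((hK.rule_preds_subset_preimage_Iic_iff hr).1 hpreds)
    exact ⟨r, ⟨hr, hhead, fun L _ hL => absurd hL not_lt_bot⟩, hlayer hr hhead⟩
  · rintro ⟨r, ⟨hr, hhead, -⟩, rfl⟩
    rw [hlayer hr hhead]
    exact ⟨hr, (hK.rule_preds_subset_preimage_Iic_iff hr).2 hhead.le⟩

theorem isModel_layerReduct_iff_eq_univ (hi : i ∉ Set.range rk) :
    (K.layerReduct rk i T).IsModel M ↔ M = Set.univ := by
  refine isModel_iff_eq_univ_of_eq_empty ?_ ?_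
  · refine Set.eq_empty_of_forall_notMem fun a ha => ?_
    obtain ⟨P, hP⟩ := (D.toFO a).preds_nonempty
    exact hi ⟨P, ha.2 hP⟩
  · exact Set.image_eq_empty.2 (Set.eq_empty_of_forall_notMem fun r hr => hi ⟨_, hr.2.1⟩)

end PartialOrder

section LinearOrder

variable [LinearOrder ι] {j : ι}

theorem IsStratified.top_bottom_ontology_of_covBy (hK : K.IsStratified rk) (hij : i ⋖ j) :
    ((K.bottom (rk ⁻¹' Set.Iic j)).top (rk ⁻¹' Set.Iic i)).ontology =
      {a ∈ K.ontology | D.preds a ⊆ rk ⁻¹' {j}} := by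
  ext a
  simp only [top, bottom, Set.mem_sdiff, Set.mem_ofPred_eq, not_and, and_assoc]
  refine and_congr_right fun ha => ?_
  obtain ⟨P, hP⟩ := (D.toFO a).preds_nonempty
  simp only [hK.axiom_preds_subset_preimage_iff ha hP, ha, Set.mem_Iic, Set.mem_singleton_iff,
    ← hij.lt_iff_le_left]
  grind

theorem IsStratified.mem_top_bottom_program_iff_of_covBy (hK : K.IsStratified rk) (hij : i ⋖ j)
    {r : Rule S} :
    r ∈ ((K.bottom (rk ⁻¹' Set.Iic j)).top (rk ⁻¹' Set.Iic i)).program ↔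
      r ∈ K.program ∧ rk r.head.pred = j := by
  simp only [top, bottom, Set.mem_sdiff, Set.mem_ofPred_eq, not_and, and_assoc]
  refine and_congr_right fun hr => ?_
  simp only [hK.rule_preds_subset_preimage_Iic_iff hr, hr, ← hij.lt_iff_le_left]
  grind

theorem IsStratified.reduct_bottom_of_covBy (hK : K.IsStratified rk) (hij : i ⋖ j) :
    (K.bottom (rk ⁻¹' Set.Iic j)).reduct (rk ⁻¹' Set.Iic i) Z =
      K.layerReduct rk j (entailedLiterals Z) := by
  refine congrArg₂ HybridKB.mk (hK.top_bottom_ontology_of_covBy hij) (Set.ext fun r' => ?_)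
  refine exists_congr fun r => ?_
  simp only [hK.mem_top_bottom_program_iff_of_covBy hij, entails_image_toMKNF_iff,
    Literal.preds_eq_singleton, Set.singleton_subset_iff, Set.mem_compl_iff, Set.mem_preimage,
    Set.mem_Iic, ← hij.lt_iff_le_left, Set.mem_ofPred_eq, Set.ofPred_subset, and_imp, and_assoc,
    Rule.layer_eq_iff]
  refine and_congr_right fun hr => and_congr_right fun hhead => and_congr_right fun _ =>
    and_congr_right fun _ => Set.ext_iff.trans <| forall_congr' fun L => ?_
  refine iff_congr Iff.rfl (and_congr_right fun hL => ?_)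
  exact ⟨fun h => ((hK.program r hr L hL).trans hhead.le).eq_of_not_lt h, fun h => h.not_lt⟩

end LinearOrder

end HybridKB

end Stratification

section SplittingSequence

variable {S : Signature} {D : DescriptionLogic S} {K : HybridKB D} {μ : Ordinal}
  {U : Ordinal → Set S.Pred}

/-- The least index below `μ` at which the predicate symbol `P` occurs in the sequence `U`. -/
noncomputable def rank (μ : Ordinal) (U : Ordinal → Set S.Pred) (P : S.Pred) : Ordinal :=
  sInf {α | α < μ ∧ P ∈ U α}

theorem rank_le {α : Ordinal} {P : S.Pred} (hα : α < μ) (hP : P ∈ U α) : rank μ U P ≤ α :=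
  csInf_le' (s := {α | α < μ ∧ P ∈ U α}) ⟨hα, hP⟩

namespace HybridKB.IsSplittingSequence

theorem rank_mem (hU : K.IsSplittingSequence μ U) (P : S.Pred) :
    rank μ U P < μ ∧ P ∈ U (rank μ U P) := by
  have hP : P ∈ ⋃ α < μ, U α := hU.cover ▸ Set.mem_univ P
  obtain ⟨α, hα, hPα⟩ := Set.mem_iUnion₂.1 hP
  exact csInf_mem (s := {α | α < μ ∧ P ∈ U α}) ⟨α, hα, hPα⟩

theorem eq_preimage_rank (hU : K.IsSplittingSequence μ U) {α : Ordinal} (hα : α < μ) :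
    U α = rank μ U ⁻¹' Set.Iic α :=
  Set.ext fun P => ⟨rank_le hα, fun h => hU.monotone _ _ h hα (hU.rank_mem P).2⟩

theorem notMem_range_rank (hU : K.IsSplittingSequence μ U) {α : Ordinal}
    (hα : Order.IsSuccLimit α) : α ∉ Set.range (rank μ U) := by
  rintro ⟨P, rfl⟩
  obtain ⟨hμ, hP⟩ := hU.rank_mem P
  rw [hU.continuous _ hμ hα] at hP
  obtain ⟨η, hη, hPη⟩ := Set.mem_iUnion₂.1 hP
  rw [hU.eq_preimage_rank (hη.trans hμ)] at hPη
  exact hη.not_ge hPη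

theorem isStratified (hU : K.IsSplittingSequence μ U) : K.IsStratified (rank μ U) := by
  constructor
  · intro a ha
    have hle (P : S.Pred) (hP : P ∈ D.preds a) (Q : S.Pred) (hQ : Q ∈ D.preds a) :
        rank μ U P ≤ rank μ U Q := by
      obtain ⟨hμ, hQU⟩ := hU.rank_mem Q
      exact rank_le hμ ((hU.splitting _ hμ).1 a ha ⟨Q, hQ, hQU⟩ hP)
    exact fun P hP Q hQ => (hle P hP Q hQ).antisymm (hle Q hQ P hP)
  · intro r hr L hL
    obtain ⟨hμ, hhead⟩ := hU.rank_mem r.head.pred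
    have hpreds : r.preds ⊆ U (rank μ U r.head.pred) :=
      (hU.splitting _ hμ).2 r hr (by
        rwa [Literal.preds_eq_singleton, Set.singleton_inter_nonempty])
    exact rank_le hμ ((Rule.preds_subset_iff.1 hpreds).2 L hL)

theorem isSolution_iff_isLayerSolution (hU : K.IsSplittingSequence μ U)
    {X : Ordinal → Set (Interp S)} :
    K.IsSolution μ U X ↔ K.IsLayerSolution (rank μ U) (Set.Iio μ) X := by
  have hzero (T : Set (Literal S)) (hμ : 0 < μ) :
      K.bottom (U 0) = K.layerReduct (rank μ U) 0 T := by
    rw [hU.eq_preimage_rank hμ, ← Ordinal.bot_eq_zero, hU.isStratified.bottom_preimage_Iic_bot]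
  have hsucc {α : Ordinal} (hα : α + 1 < μ) :
      (K.bottom (U (α + 1))).reduct (U α) (⋂ η ≤ α, X η) =
        K.layerReduct (rank μ U) (α + 1) (entailedLiterals (⋂ η < α + 1, X η)) := by
    have hcovBy : α ⋖ α + 1 := Order.covBy_add_one α
    simp only [hU.eq_preimage_rank hα, hU.eq_preimage_rank (hcovBy.lt.trans hα),
      hU.isStratified.reduct_bottom_of_covBy hcovBy, Order.lt_add_one_iff]
  constructor
  · intro hX α hα
    rcases Ordinal.zero_or_succ_or_isSuccLimit α with rfl | ⟨α, rfl⟩ | hlim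
    · exact hzero _ hα ▸ hX.zero hα
    · exact hsucc hα ▸ hX.succ α hα
    · exact (isModel_layerReduct_iff_eq_univ (hU.notMem_range_rank hlim)).2 (hX.limit α hα hlim)
  · intro hX
    exact
      { nonempty := hX.isLayerFamily.nonempty
        zero := fun hμ => hzero _ hμ ▸ hX 0 hμ
        succ := fun α hα => hsucc hα ▸ hX (α + 1) hα
        limit := fun α hα hlim =>
          (isModel_layerReduct_iff_eq_univ (hU.notMem_range_rank hlim)).1 (hX α hα) }

end HybridKB.IsSplittingSequence

end SplittingSequence

end MKNF

theorem theorem2 {S : MKNF.Signature} {D : MKNF.DescriptionLogic S} (K : MKNF.HybridKB D)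
    (μ : Ordinal) (U : Ordinal → Set S.Pred) (hU : K.IsSplittingSequence μ U)
    (M : Set (MKNF.Interp S)) :
    K.IsModel M ↔
      ∃ X : Ordinal → Set (MKNF.Interp S), K.IsSolution μ U X ∧ M = ⋂ α < μ, X α := by
  rw [hU.isStratified.isModel_iff_exists_isLayerSolution (isLowerSet_Iio μ)
    fun P => (hU.rank_mem P).1]
  exact exists_congr fun X => and_congr_left' hU.isSolution_iff_isLayerSolution.symm
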